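/- Let $n\ge 1$ and $k\ge 0$ be integers. A rooted labelled tree on $[n]=\{1,\dots,n\}$ is a tree with vertex set $[n]$ together with a vertex chosen as its root. A vertex $v$ of such a tree is a record if its label is the largest among the labels of all the vertices on the unique path from the root to $v$, both ends included (so the root is always a record). Let $R_\bullet(n,k)$ be the number of rooted labelled trees on $[n]$ with exactly $k$ records. Then $$R_\bullet(n,k)=k\,(n-1)(n-2)\cdots(n-k+1)\,n^{\,n-k-1},$$ as an identity of rational numbers (the exponent $n-k-1$ may be negative). Here the product $(n-1)\cdots(n-k+1)=\prod_{1\le i<k}(n-i)$ is read as $1$ when $k\le 1$; in particular both sides are $0$ when $k=0$ or $k>n$. -/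

import Mathlib

/-- A rooted labelled tree on the vertex set `V`: a graph on `V` which is a tree, together with
a vertex chosen as the root. The labels are the vertices themselves. -/
structure RootedLabelledTree (V : Type*) where
  /-- the underlying graph -/
  graph : SimpleGraph V
  /-- the underlying graph is a tree (connected and acyclic) -/
  isTree : graph.IsTree
  /-- the root -/
  root : V

namespace RootedLabelledTree

/-- A vertex is a record if its label is the largest along the (unique) path from the root to
it, both ends included. In particular the root is always a record. -/
def IsRecord {V : Type*} [LinearOrder V] (T : RootedLabelledTree V) (v : V) : Prop :=
  ∀ p : T.graph.Walk T.root v, p.IsPath → ∀ w ∈ p.support, w ≤ v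

/-- The number of records of a rooted tree. -/
noncomputable def numRecords {V : Type*} [LinearOrder V] (T : RootedLabelledTree V) : ℕ :=
  {v : V | T.IsRecord v}.ncard

end RootedLabelledTree

/-- The tree record number: the number of rooted trees labelled with `[n]` (here `Fin n`, whose
element `i` stands for the label `i + 1`) that have exactly `k` records. -/
noncomputable def treeRecordNumber (n k : ℕ) : ℕ :=
  {T : RootedLabelledTree (Fin n) | T.numRecords = k}.ncard

/-! Rooted trees are encoded as parent maps, and records are counted by cutting at the largest label
`M`. The root and `M` are always records, so there is exactly one record iff `M` is the root.
Otherwise cut the edge from `M` to its parent `u`. What remains is a rooted tree on a set `A`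
containing `u` but not `M`, and a tree on `S \ A` rooted at `M`. The proper descendants of `M` are
not records, and ancestor paths inside `A` are unchanged, so the tree on `A` has exactly one record
fewer (`card_recordMaps_add_two`).

The resulting recursion involves the number `t(n)` of trees with a prescribed root. Induction on `n`
therefore proves the formula together with Cayley's `t(n) = n^(n-2)`. The closed form satisfies the
same recursion by Abel's identity (`sum_choose_mul_recordFormula`), which settles every `k ≠ 1`. The
case `k = 1` is `t(n)` itself; it follows from counting all rooted trees by records and by root,
since the closed form sums to `n^(n-1)` (`sum_recordFormula`). -/

/-! ### Abel's binomial identities -/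

-- Induction on `m`: by the previous case at `X + 1`, both sides have the same derivative, so they
-- differ by a constant. The constant is found at `X = -(x + k + 1)`, where the right side vanishes
-- and the left side is `x` times a `(k+1)`-st finite difference of `t ^ k`.
open Finset Polynomial in
theorem abel_binomial_polynomial {x : ℚ} (hx : 0 < x) (m : ℕ) :
    ∑ j ∈ range (m + 1), C ((m.choose j : ℚ) * (x * (x + j) ^ ((j : ℤ) - 1))) *
      (X + C ((m - j : ℕ) : ℚ)) ^ (m - j) = (X + C (x + m)) ^ m := by
  induction m with
  | zero =>
    simp only [zero_add, range_one, sum_singleton, Nat.choose_self, Nat.cast_zero, zero_sub]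
    simp [mul_inv_cancel₀ hx.ne', -map_mul, -map_inv₀]
  | succ k ih =>
    have hd : derivative (∑ j ∈ range (k + 1 + 1),
        C (((k + 1).choose j : ℚ) * (x * (x + j) ^ ((j : ℤ) - 1))) *
        (X + C ((k + 1 - j : ℕ) : ℚ)) ^ (k + 1 - j) - (X + C (x + (k + 1 : ℕ))) ^ (k + 1)) = 0 := by
      have h1 := congrArg (fun p : ℚ[X] => C ((k : ℚ) + 1) * p.comp (X + 1)) ih
      simp only [Polynomial.sum_comp, Polynomial.mul_comp, C_comp, pow_comp, Polynomial.add_comp,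
        X_comp] at h1
      rw [derivative_sub, sum_range_succ, derivative_add, derivative_sum, sub_eq_zero]
      have h2 : derivative (((X : ℚ[X]) + C (x + (k + 1 : ℕ))) ^ (k + 1)) =
          C ((k : ℚ) + 1) * (X + 1 + C (x + k)) ^ k := by
        rw [derivative_X_add_C_pow]
        push_cast
        simp only [map_add, map_one, map_natCast]
        ring
      rw [h2, ← h1, mul_sum]
      simp only [Nat.sub_self, pow_zero, mul_one, derivative_C, add_zero]
      refine sum_congr rfl fun j hj => ?_
      have hj' : j ≤ k := by simpa [Nat.lt_succ_iff] using hj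
      have e : k + 1 - j = (k - j) + 1 := by omega
      have hc : ((k + 1).choose j : ℚ) * ((k - j : ℕ) + 1) = (k + 1) * k.choose j := by
        have := Nat.choose_mul_succ_eq k j
        rw [e] at this
        have h := congrArg (Nat.cast : ℕ → ℚ) this
        push_cast at h
        linarith
      rw [derivative_C_mul, e, derivative_X_add_C_pow]
      have hc' := congrArg (C : ℚ → ℚ[X]) hc
      simp only [Nat.add_sub_cancel, map_mul, map_add, map_one, map_natCast, Nat.cast_add,
        Nat.cast_one] at hc' ⊢
      linear_combination (C x * C ((x + (j : ℚ)) ^ ((j : ℤ) - 1)) *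
        (X + 1 + ((k - j : ℕ) : ℚ[X])) ^ (k - j)) * hc'
    have hC := eq_C_of_derivative_eq_zero hd
    set Q := ∑ j ∈ range (k + 1 + 1),
        C (((k + 1).choose j : ℚ) * (x * (x + j) ^ ((j : ℤ) - 1))) *
        (X + C ((k + 1 - j : ℕ) : ℚ)) ^ (k + 1 - j) - (X + C (x + (k + 1 : ℕ))) ^ (k + 1) with hQ
    have hev : Q.eval (-(x + (k + 1 : ℕ))) = 0 := by
      have hf := congrFun (fwdDiff_iter_pow_eq_zero_of_lt (R := ℚ) (Nat.lt_succ_self k)) x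
      rw [fwdDiff_iter_eq_sum_shift] at hf
      simp only [hQ, eval_sub, eval_finsetSum, eval_mul, eval_C, eval_pow, eval_add, eval_X,
        neg_add_cancel, zero_pow (Nat.succ_ne_zero k), sub_zero]
      rw [← mul_zero x, ← Pi.zero_apply (M := fun _ : ℚ => ℚ) x, ← hf, mul_sum]
      refine sum_congr rfl fun j hj => ?_
      have hj' : j ≤ k + 1 := by simpa [Nat.lt_succ_iff] using hj
      have hpos : x + j ≠ 0 := by positivity
      rw [Nat.cast_sub hj']
      have e1 : -(x + ((k + 1 : ℕ) : ℚ)) + (((k + 1 : ℕ) : ℚ) - j) = -(x + j) := by ring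
      have e2 : (x + j : ℚ) ^ ((j : ℤ) - 1) * (x + j) ^ (k + 1 - j) = (x + j) ^ k := by
        rw [← zpow_natCast, ← zpow_natCast, ← zpow_add₀ hpos]
        congr 1
        push_cast [hj']
        ring
      rw [e1, neg_pow, zsmul_eq_mul, nsmul_one, ← e2]
      push_cast
      ring
    have h0 : Q.coeff 0 = 0 := by
      rw [hC] at hev
      simpa using hev
    rw [h0, map_zero] at hC
    exact sub_eq_zero.mp hC

open Finset Polynomial in
theorem abel_binomial {x : ℚ} (hx : 0 < x) (y : ℚ) (m : ℕ) :
    ∑ j ∈ range (m + 1), (m.choose j : ℚ) * (x * (x + j) ^ ((j : ℤ) - 1)) *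
      (y + (m - j : ℕ)) ^ (m - j) = (x + y + m) ^ m := by
  have h := congrArg (eval y) (abel_binomial_polynomial hx m)
  simp only [eval_finsetSum, eval_mul, eval_C, eval_pow, eval_add, eval_X] at h
  rw [h]
  ring

-- Since `y(y+d)^(d-1) = (y+d)^d - d(y+d)^(d-1)`, the sum is Abel's identity at `(y, m)` minus `m`
-- times the one at `(y + 1, m - 1)`.
open Finset in
theorem abel_binomial_symm {x y : ℚ} (hx : 0 < x) (hy : 0 < y) (m : ℕ) :
    ∑ j ∈ range (m + 1), (m.choose j : ℚ) * (x * (x + j) ^ ((j : ℤ) - 1)) *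
      (y * (y + (m - j : ℕ)) ^ (((m - j : ℕ) : ℤ) - 1)) =
      (x + y) * (x + y + m) ^ ((m : ℤ) - 1) := by
  cases m with
  | zero => simp [hx.ne', hy.ne', (add_pos hx hy).ne']
  | succ k =>
    have key (d : ℕ) : y * (y + d) ^ ((d : ℤ) - 1) =
        (y + d) ^ d - d * (y + d) ^ ((d : ℤ) - 1) := by
      have hpos : y + d ≠ 0 := by positivity
      rw [← zpow_natCast, zpow_sub_one₀ hpos]
      field_simp
      ring
    simp_rw [key, mul_sub, sum_sub_distrib, abel_binomial hx]
    have h2 := abel_binomial hx (y + 1) k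
    rw [sum_range_succ _ (k + 1)]
    simp only [Nat.sub_self, Nat.cast_zero, zero_mul, mul_zero, add_zero]
    have h3 : ∑ j ∈ range (k + 1), ((k + 1).choose j : ℚ) * (x * (x + j) ^ ((j : ℤ) - 1)) *
        (((k + 1 - j : ℕ) : ℚ) * (y + (k + 1 - j : ℕ)) ^ (((k + 1 - j : ℕ) : ℤ) - 1)) =
        (k + 1) * (x + (y + 1) + k) ^ k := by
      rw [← h2, mul_sum]
      refine sum_congr rfl fun j hj => ?_
      have hj' : j ≤ k := by simpa [Nat.lt_succ_iff] using hj
      have e : k + 1 - j = (k - j) + 1 := by omega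
      have hc : ((k + 1).choose j : ℚ) * ((k - j : ℕ) + 1) = (k + 1) * k.choose j := by
        have := Nat.choose_mul_succ_eq k j
        rw [e] at this
        have h := congrArg (Nat.cast : ℕ → ℚ) this
        push_cast at h
        linarith
      rw [e, Nat.cast_succ (k - j), Nat.cast_succ (k - j), add_sub_cancel_right, zpow_natCast,
        add_comm ((k - j : ℕ) : ℚ) 1, ← add_assoc]
      linear_combination x * (x + j) ^ ((j : ℤ) - 1) * (y + 1 + (k - j : ℕ)) ^ (k - j) * hc
    rw [h3]
    push_cast
    rw [add_sub_cancel_right, zpow_natCast]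
    ring

/-! ### Identities for the closed form -/

/-- The closed form `k (n-1) ⋯ (n-k+1) n ^ (n-k-1)`. -/
def recordFormula (n k : ℕ) : ℚ :=
  (k : ℚ) * (∏ i ∈ Finset.Ico 1 k, ((n : ℚ) - (i : ℚ))) * (n : ℚ) ^ ((n : ℤ) - (k : ℤ) - 1)

-- Writing `k = n - (n - k)` makes the sum telescope in `n(n-1)⋯(n-k+1) n^(n-k-1)`, which vanishes
-- at `k = n + 1`.
open Finset in
theorem sum_recordFormula {n : ℕ} (hn : 1 ≤ n) :
    ∑ k ∈ range (n + 1), recordFormula n k = (n : ℚ) ^ ((n : ℤ) - 1) := by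
  have hn0 : (n : ℚ) ≠ 0 := by positivity
  have h (k : ℕ) : recordFormula n k =
      (∏ i ∈ range k, ((n : ℚ) - i)) * (n : ℚ) ^ ((n : ℤ) - k - 1) -
      (∏ i ∈ range (k + 1), ((n : ℚ) - i)) * (n : ℚ) ^ ((n : ℤ) - (k + 1 : ℕ) - 1) := by
    have e : (n : ℤ) - k - 1 = ((n : ℤ) - (k + 1 : ℕ) - 1) + 1 := by push_cast; ring
    rw [recordFormula, e, zpow_add_one₀ hn0, prod_range_succ]
    cases k with
    | zero => simp; ring
    | succ l =>
      rw [range_eq_Ico, prod_eq_prod_Ico_succ_bot (Nat.succ_pos l)]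
      push_cast
      ring
  simp_rw [h]
  rw [sum_range_sub', prod_eq_zero (i := n) (s := range (n + 1)) (by simp) (by simp)]
  simp

open Finset in
theorem prod_Ico_one_sub_natCast (a k : ℕ) :
    ∏ i ∈ Ico 1 (k + 1), (((a + 1 : ℕ) : ℚ) - i) = (a.descFactorial k : ℚ) := by
  rw [← descPochhammer_eval_eq_descFactorial, descPochhammer_eval_eq_prod_range,
    prod_Ico_eq_prod_range]
  refine prod_congr rfl fun i _ => ?_
  push_cast
  ring

-- Put `n = k + 2 + m` and `s = k + 1 + j`. The falling factorial inside the summand turns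
-- `(n-1).choose s` into a constant times `m.choose j`, leaving the symmetric Abel identity at `x =
-- k + 1`, `y = 1`.
open Finset in
theorem sum_choose_mul_recordFormula {n : ℕ} (hn : 1 ≤ n) (k : ℕ) :
    ∑ s ∈ range n, ((n - 1).choose s : ℚ) *
      (recordFormula s (k + 1) * s * ((n - s : ℕ) : ℚ) ^ (((n - s : ℕ) : ℤ) - 2)) =
      recordFormula n (k + 2) := by
  have hvan (s : ℕ) (hs : s < k + 1) : recordFormula s (k + 1) * s = 0 := by
    rcases Nat.eq_zero_or_pos s with rfl | h
    · simp
    · rw [recordFormula, prod_eq_zero (i := s) (by simp; omega) (by simp)]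
      simp
  rcases lt_or_ge n (k + 2) with h | h
  · rw [sum_eq_zero fun s hs => by rw [hvan s (by have := mem_range.mp hs; omega)]; simp]
    rw [recordFormula, prod_eq_zero (i := n) (by simp; omega) (by simp)]
    simp
  · obtain ⟨m, rfl⟩ := Nat.exists_eq_add_of_le h
    rw [show k + 2 + m = (k + 1) + (m + 1) by ring, sum_range_add,
      sum_eq_zero fun s hs => by rw [hvan s (mem_range.mp hs)]; simp, zero_add]
    have hab := abel_binomial_symm (x := (k + 1 : ℕ)) (y := 1) (by positivity) one_pos m
    rw [recordFormula]
    have hP : ∏ i ∈ Ico 1 (k + 2), (((k + 1 + (m + 1) : ℕ) : ℚ) - i) =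
        ((k + 1 + m).descFactorial (k + 1) : ℚ) :=
      prod_Ico_one_sub_natCast (k + 1 + m) (k + 1)
    rw [hP]
    have hz : (((k + 1 + (m + 1) : ℕ) : ℤ) - (k + 2 : ℕ) - 1) = (m : ℤ) - 1 := by push_cast; ring
    rw [hz]
    have hR : ((k + 2 : ℕ) : ℚ) * ((k + 1 + m).descFactorial (k + 1) : ℚ) *
        ((k + 1 + (m + 1) : ℕ) : ℚ) ^ ((m : ℤ) - 1) = ((k + 1 + m).descFactorial (k + 1) : ℚ) *
        ((((k + 1 : ℕ) : ℚ) + 1) * (((k + 1 : ℕ) : ℚ) + 1 + m) ^ ((m : ℤ) - 1)) := by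
      have e : ((k + 1 + (m + 1) : ℕ) : ℚ) = ((k + 1 : ℕ) : ℚ) + 1 + m := by push_cast; ring
      rw [e]
      push_cast
      ring
    rw [hR, ← hab, mul_sum]
    refine sum_congr rfl fun j hj => ?_
    have hj' : j ≤ m := by simpa [Nat.lt_succ_iff] using hj
    have hQ : (∏ i ∈ Ico 1 (k + 1), (((k + 1 + j : ℕ) : ℚ) - i)) * ((k + 1 + j : ℕ) : ℚ) =
        ((k + 1 + j).descFactorial (k + 1) : ℚ) := by
      rw [show k + 1 + j = k + j + 1 by ring, prod_Ico_one_sub_natCast,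
        Nat.succ_descFactorial_succ]
      push_cast
      ring
    have hch : ((k + 1 + m).choose (k + 1 + j) : ℚ) * ((k + 1 + j).descFactorial (k + 1) : ℚ) =
        ((k + 1 + m).descFactorial (k + 1) : ℚ) * m.choose j := by
      have := Nat.choose_mul (n := k + 1 + m) (k := k + 1 + j) (s := k + 1) (by omega)
      rw [Nat.add_sub_cancel_left, Nat.add_sub_cancel_left] at this
      rw [Nat.descFactorial_eq_factorial_mul_choose, Nat.descFactorial_eq_factorial_mul_choose]
      have h := congrArg (Nat.cast : ℕ → ℚ) this
      push_cast at h ⊢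
      linear_combination ((k + 1).factorial : ℚ) * h
    have e1 : k + 1 + (m + 1) - 1 = k + 1 + m := by omega
    have e2 : k + 1 + (m + 1) - (k + 1 + j) = (m - j) + 1 := by omega
    rw [e1, e2, recordFormula]
    have e3 : ((k + 1 + j : ℕ) : ℤ) - (k + 1 : ℕ) - 1 = (j : ℤ) - 1 := by push_cast; ring
    have e4 : (((m - j + 1 : ℕ) : ℤ) - 2) = ((m - j : ℕ) : ℤ) - 1 := by push_cast; ring
    have e5 : (((m - j + 1 : ℕ) : ℚ)) = 1 + ((m - j : ℕ) : ℚ) := by push_cast; ring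
    have e6 : ((k + 1 : ℕ) : ℚ) + j = ((k + 1 + j : ℕ) : ℚ) := by push_cast; ring
    rw [e3, e4, e5, e6]
    generalize ((k + 1 + j : ℕ) : ℚ) ^ ((j : ℤ) - 1) = a at *
    generalize (1 + ((m - j : ℕ) : ℚ)) ^ (((m - j : ℕ) : ℤ) - 1) = b at *
    rw [← hQ] at hch
    linear_combination ((k + 1 : ℕ) : ℚ) * a * b * hch

/-! ### Rooted trees as parent maps -/

/-- `p` sends every vertex of `S` to its parent in a tree on `S` rooted at `r`; the root and the
vertices outside `S` are fixed. -/
structure IsParentMap {V : Type*} (p : V → V) (S : Finset V) (r : V) : Prop where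
  root_mem : r ∈ S
  map_root : p r = r
  map_mem : ∀ v ∈ S, p v ∈ S
  reach : ∀ v ∈ S, ∃ k, p^[k] v = r
  map_of_notMem : ∀ v, v ∉ S → p v = v

theorem iterate_eq_of_eqOn {V : Type*} {f g : V → V} {A : Finset V}
    (hf : ∀ v ∈ A, f v ∈ A) (h : ∀ v ∈ A, g v = f v) (k : ℕ) :
    ∀ v ∈ A, g^[k] v = f^[k] v ∧ f^[k] v ∈ A := by
  induction k with
  | zero => simp
  | succ k ih =>
    intro v hv
    rw [Function.iterate_succ_apply, Function.iterate_succ_apply, h v hv]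
    exact ih _ (hf v hv)

namespace IsParentMap

variable {V : Type*} {p : V → V} {S : Finset V} {r : V}

theorem iterate_mem (h : IsParentMap p S r) (k : ℕ) {v : V} (hv : v ∈ S) : p^[k] v ∈ S :=
  (iterate_eq_of_eqOn h.map_mem (fun _ _ => rfl) k v hv).2

theorem root_unique {r' : V} (h : IsParentMap p S r) (h' : IsParentMap p S r') : r = r' := by
  obtain ⟨k, hk⟩ := h'.reach r h.root_mem
  rw [← hk, Function.iterate_fixed h.map_root]

/-- Going round a cycle often enough passes the root, where the iteration stays. -/
theorem eq_root_of_iterate_eq (h : IsParentMap p S r) {v : V} (hv : v ∈ S) {k : ℕ}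
    (hk : p^[k + 1] v = v) : v = r := by
  obtain ⟨l, hl⟩ := h.reach v hv
  have h1 : (p^[k + 1])^[l] v = v := Function.iterate_fixed hk l
  rw [← Function.iterate_mul, show (k + 1) * l = k * l + l by ring, Function.iterate_add_apply, hl,
    Function.iterate_fixed h.map_root] at h1
  exact h1.symm

/-- Relabelling by a transposition moves the root, so the number of trees on `S` does not depend on
the prescribed root. -/
theorem conj_swap [DecidableEq V] {r' : V} (h : IsParentMap p S r) (hr' : r' ∈ S) :
    IsParentMap (Equiv.swap r r' ∘ p ∘ Equiv.swap r r') S r' := by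
  have hs : ∀ v ∈ S, Equiv.swap r r' v ∈ S := fun v hv => by
    rw [Equiv.swap_apply_def]
    split_ifs
    exacts [hr', h.root_mem, hv]
  have hit (k : ℕ) (v : V) : (Equiv.swap r r' ∘ p ∘ Equiv.swap r r')^[k] v =
      Equiv.swap r r' (p^[k] (Equiv.swap r r' v)) := by
    induction k with
    | zero => simp
    | succ k ih => rw [Function.iterate_succ_apply', ih, Function.iterate_succ_apply']; simp
  refine ⟨hr', by simp [h.map_root], fun v hv => hs _ (h.map_mem _ (hs _ hv)), fun v hv => ?_,
    fun v hv => ?_⟩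
  · obtain ⟨k, hk⟩ := h.reach _ (hs v hv)
    exact ⟨k, by rw [hit, hk, Equiv.swap_apply_left]⟩
  · have h1 : Equiv.swap r r' v = v := Equiv.swap_apply_of_ne_of_ne
      (fun e => hv (e ▸ h.root_mem)) (fun e => hv (e ▸ hr'))
    simp [h1, h.map_of_notMem v hv]

end IsParentMap

open scoped Classical in
/-- The vertices of `S` that are maximal among their ancestors. -/
noncomputable def recordSet {V : Type*} [LinearOrder V] (p : V → V) (S : Finset V) : Finset V :=
  S.filter fun v => ∀ k, p^[k] v ≤ v

theorem mem_recordSet {V : Type*} [LinearOrder V] {p : V → V} {S : Finset V} {v : V} :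
    v ∈ recordSet p S ↔ v ∈ S ∧ ∀ k, p^[k] v ≤ v := by
  simp [recordSet]

open scoped Classical in
/-- The parent maps of trees on `S` rooted at `r`. -/
noncomputable def parentMaps {V : Type*} [Fintype V] (S : Finset V) (r : V) : Finset (V → V) :=
  Finset.univ.filter fun p => IsParentMap p S r

open scoped Classical in
/-- The parent maps of rooted trees on `S` with `k` records. -/
noncomputable def recordMaps {V : Type*} [Fintype V] [LinearOrder V] (S : Finset V) (k : ℕ) :
    Finset (V → V) :=
  Finset.univ.filter fun p => (∃ r, IsParentMap p S r) ∧ (recordSet p S).card = k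

theorem mem_parentMaps {V : Type*} [Fintype V] {p : V → V} {S : Finset V} {r : V} :
    p ∈ parentMaps S r ↔ IsParentMap p S r := by
  simp [parentMaps]

theorem card_parentMaps_singleton {V : Type*} [Fintype V] (r : V) : (parentMaps {r} r).card = 1 := by
  refine Finset.card_eq_one.mpr ⟨id, Finset.eq_singleton_iff_unique_mem.mpr
    ⟨mem_parentMaps.mpr ⟨by simp, rfl, by simp, fun v hv => ⟨0, by simpa using hv⟩,
      fun _ _ => rfl⟩, fun p hp => ?_⟩⟩
  have hp := mem_parentMaps.mp hp
  funext v
  by_cases hv : v = r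
  · rw [hv, hp.map_root, id]
  · exact hp.map_of_notMem v (by simpa using hv)

section Counting

variable {V : Type*} [LinearOrder V] {p : V → V} {S : Finset V} {r : V}

theorem mem_recordMaps [Fintype V] {k : ℕ} :
    p ∈ recordMaps S k ↔ (∃ r, IsParentMap p S r) ∧ (recordSet p S).card = k := by
  simp [recordMaps]

theorem IsParentMap.root_mem_recordSet (h : IsParentMap p S r) : r ∈ recordSet p S :=
  mem_recordSet.mpr ⟨h.root_mem, fun k => (Function.iterate_fixed h.map_root k).le⟩

theorem IsParentMap.max_mem_recordSet (h : IsParentMap p S r) {M : V} (hM : M ∈ S)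
    (hmax : ∀ v ∈ S, v ≤ M) : M ∈ recordSet p S :=
  mem_recordSet.mpr ⟨hM, fun k => hmax _ (h.iterate_mem k hM)⟩

theorem card_parentMaps_le [Fintype V] {r' : V} (hr' : r' ∈ S) :
    (parentMaps S r).card ≤ (parentMaps S r').card := by
  refine Finset.card_le_card_of_injOn (fun p => Equiv.swap r r' ∘ p ∘ Equiv.swap r r')
    (fun p hp => mem_parentMaps.mpr ((mem_parentMaps.mp hp).conj_swap hr')) fun p _ q _ hpq => ?_
  funext v
  have := congrFun hpq (Equiv.swap r r' v)
  simpa using this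

theorem card_parentMaps_eq [Fintype V] {r' : V} (hr : r ∈ S) (hr' : r' ∈ S) :
    (parentMaps S r).card = (parentMaps S r').card :=
  (card_parentMaps_le hr').antisymm (card_parentMaps_le hr)

theorem recordMaps_zero [Fintype V] : recordMaps S 0 = ∅ := by
  refine Finset.eq_empty_of_forall_notMem fun p hp => ?_
  obtain ⟨⟨r, hr⟩, h0⟩ := mem_recordMaps.mp hp
  rw [Finset.card_eq_zero] at h0
  simpa [h0] using hr.root_mem_recordSet

theorem recordMaps_one [Fintype V] {M : V} (hM : M ∈ S) (hmax : ∀ v ∈ S, v ≤ M) :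
    recordMaps S 1 = parentMaps S M := by
  ext p
  rw [mem_recordMaps, mem_parentMaps]
  constructor
  · rintro ⟨⟨r, hr⟩, h1⟩
    rwa [Finset.card_le_one.mp h1.le _ hr.root_mem_recordSet _ (hr.max_mem_recordSet hM hmax)]
      at hr
  · intro h
    refine ⟨⟨M, h⟩, Finset.card_eq_one.mpr ⟨M, Finset.eq_singleton_iff_unique_mem.mpr
      ⟨h.root_mem_recordSet, fun v hv => ?_⟩⟩⟩
    obtain ⟨hv, hrec⟩ := mem_recordSet.mp hv
    obtain ⟨k, hk⟩ := h.reach v hv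
    exact le_antisymm (hmax v hv) (hk ▸ hrec k)

/-- Both sides count all rooted trees on `S`, by number of records and by root. -/
theorem sum_card_recordMaps [Fintype V] (hr : r ∈ S) :
    ∑ k ∈ Finset.range (S.card + 1), (recordMaps S k).card = S.card * (parentMaps S r).card := by
  rw [← smul_eq_mul, ← Finset.sum_const, Finset.sum_congr rfl fun s hs => card_parentMaps_eq hr hs,
    ← Finset.card_biUnion, ← Finset.card_biUnion]
  · congr 1
    ext p
    simp only [Finset.mem_biUnion, mem_recordMaps, mem_parentMaps, Finset.mem_range]
    constructor
    · rintro ⟨_, _, ⟨s, hs⟩, _⟩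
      exact ⟨s, hs.root_mem, hs⟩
    · rintro ⟨s, _, hs⟩
      exact ⟨_, Nat.lt_succ_of_le (Finset.card_le_card fun v hv => (mem_recordSet.mp hv).1),
        ⟨s, hs⟩, rfl⟩
  · intro s _ t _ hst
    refine Finset.disjoint_left.mpr fun p hp hq => hst ?_
    exact (mem_parentMaps.mp hp).root_unique (mem_parentMaps.mp hq)
  · intro s _ t _ hst
    refine Finset.disjoint_left.mpr fun p hp hq => hst ?_
    exact (mem_recordMaps.mp hp).2.symm.trans (mem_recordMaps.mp hq).2

/-! ### Cutting and grafting at the largest label -/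

/-- Graft the tree `q`, rooted at `M`, onto the vertex `u` of the tree `p` on `A`. -/
def graft (M : V) (A : Finset V) (p : V → V) (u : V) (q : V → V) (v : V) : V :=
  if v ∈ A then p v else if v = M then u else q v

theorem graft_iterate {M u : V} {A : Finset V} {p q : V → V} (hp : IsParentMap p A r) (k : ℕ)
    {v : V} (hv : v ∈ A) : (graft M A p u q)^[k] v = p^[k] v ∧ p^[k] v ∈ A :=
  iterate_eq_of_eqOn hp.map_mem (fun v hv => by simp [graft, hv]) k v hv

theorem graft_reach {M u : V} {A : Finset V} {p q : V → V} (hq : IsParentMap q (S \ A) M)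
    {v : V} (hv : v ∈ S \ A) : ∃ k, (graft M A p u q)^[k] v = M := by
  obtain ⟨k, hk⟩ := hq.reach v hv
  induction k generalizing v with
  | zero => exact ⟨0, hk⟩
  | succ k ih =>
    by_cases hvM : v = M
    · exact ⟨0, hvM⟩
    · obtain ⟨l, hl⟩ := ih (hq.map_mem v hv) hk
      refine ⟨l + 1, ?_⟩
      rw [Function.iterate_succ_apply]
      simpa [graft, hvM, (Finset.mem_sdiff.mp hv).2] using hl

theorem graft_isParentMap {M u : V} {A : Finset V} {p q : V → V} (hA : A ⊆ S)
    (hp : IsParentMap p A r) (hu : u ∈ A) (hq : IsParentMap q (S \ A) M) :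
    IsParentMap (graft M A p u q) S r := by
  have hMA := (Finset.mem_sdiff.mp hq.root_mem)
  refine ⟨hA hp.root_mem, by simp [graft, hp.root_mem, hp.map_root], fun v hv => ?_, fun v hv => ?_,
    fun v hv => ?_⟩
  · unfold graft
    split_ifs with h1 h2
    · exact hA (hp.map_mem v h1)
    · exact hA hu
    · exact (Finset.mem_sdiff.mp (hq.map_mem v (Finset.mem_sdiff.mpr ⟨hv, h1⟩))).1
  · by_cases h1 : v ∈ A
    · obtain ⟨k, hk⟩ := hp.reach v h1
      exact ⟨k, by rw [(graft_iterate hp k h1).1, hk]⟩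
    · obtain ⟨k, hk⟩ := graft_reach (p := p) (u := u) hq (Finset.mem_sdiff.mpr ⟨hv, h1⟩)
      obtain ⟨l, hl⟩ := hp.reach u hu
      refine ⟨l + 1 + k, ?_⟩
      rw [Function.iterate_add_apply, hk, Function.iterate_succ_apply]
      have : graft M A p u q M = u := by simp [graft, hMA.2]
      rw [this, (graft_iterate hp l hu).1, hl]
  · have h1 : v ∉ A := fun h => hv (hA h)
    have h2 : v ≠ M := fun h => hv (h ▸ hMA.1)
    simpa [graft, h1, h2] using hq.map_of_notMem v (by simp [hv])

/-- Recovers `A` from the grafted map, which gives injectivity of grafting. -/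
theorem mem_iff_graft_iterate_ne {M u : V} {A : Finset V} {p q : V → V}
    (hp : IsParentMap p A r) (hq : IsParentMap q (S \ A) M) {v : V} (hv : v ∈ S) :
    v ∈ A ↔ ∀ k, (graft M A p u q)^[k] v ≠ M := by
  constructor
  · intro h k e
    rw [(graft_iterate hp k h).1] at e
    exact (Finset.mem_sdiff.mp hq.root_mem).2
      (e ▸ (graft_iterate (M := M) (u := u) (q := q) hp k h).2)
  · intro h
    by_contra h1
    obtain ⟨k, hk⟩ := graft_reach (p := p) (u := u) hq (Finset.mem_sdiff.mpr ⟨hv, h1⟩)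
    exact h k hk

theorem card_recordSet_graft {M u : V} {A : Finset V} {p q : V → V} (hA : A ⊆ S)
    (hmax : ∀ v ∈ S, v ≤ M) (hp : IsParentMap p A r) (hu : u ∈ A)
    (hq : IsParentMap q (S \ A) M) :
    (recordSet (graft M A p u q) S).card = (recordSet p A).card + 1 := by
  have hMA := (Finset.mem_sdiff.mp hq.root_mem)
  have hg := graft_isParentMap hA hp hu hq
  have hM : M ∉ recordSet p A := fun h => hMA.2 (mem_recordSet.mp h).1
  rw [← Finset.card_insert_of_notMem hM]
  congr 1
  ext v
  rw [Finset.mem_insert, mem_recordSet, mem_recordSet]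
  constructor
  · rintro ⟨hv, hrec⟩
    by_cases h1 : v ∈ A
    · exact Or.inr ⟨h1, fun k => (graft_iterate hp k h1).1 ▸ hrec k⟩
    · obtain ⟨k, hk⟩ := graft_reach (p := p) (u := u) hq (Finset.mem_sdiff.mpr ⟨hv, h1⟩)
      exact Or.inl (le_antisymm (hmax v hv) (hk ▸ hrec k))
  · rintro (rfl | ⟨hv, hrec⟩)
    · exact mem_recordSet.mp (hg.max_mem_recordSet hMA.1 hmax)
    · exact ⟨hA hv, fun k => (graft_iterate hp k hv).1 ▸ hrec k⟩

theorem exists_eq_graft {M : V} (hp : IsParentMap p S r) (hM : M ∈ S) (hr : r ≠ M) :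
    ∃ A ⊆ S.erase M, ∃ p' q, IsParentMap p' A r ∧ p M ∈ A ∧ IsParentMap q (S \ A) M ∧
      graft M A p' (p M) q = p := by
  classical
  -- `A` consists of the vertices that are not descendants of `M`.
  set A := S.filter fun v => ∀ k, p^[k] v ≠ M with hAdef
  have hA (v : V) : v ∈ A ↔ v ∈ S ∧ ∀ k, p^[k] v ≠ M := by simp [hAdef]
  have hMA : M ∉ A := fun h => ((hA M).mp h).2 0 rfl
  have hmap : ∀ v ∈ A, p v ∈ A := fun v hv =>
    (hA _).mpr ⟨hp.map_mem v ((hA v).mp hv).1, fun k => ((hA v).mp hv).2 (k + 1)⟩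
  refine ⟨A, fun v hv => Finset.mem_erase.mpr ⟨fun e => hMA (e ▸ hv), ((hA v).mp hv).1⟩,
    fun v => if v ∈ A then p v else v, fun v => if v ∈ S \ A ∧ v ≠ M then p v else v,
    ⟨?_, ?_, ?_, ?_, ?_⟩, ?_, ⟨?_, ?_, ?_, ?_, ?_⟩, ?_⟩
  · exact (hA r).mpr ⟨hp.root_mem, fun k => by rwa [Function.iterate_fixed hp.map_root]⟩
  · simp [hp.map_root]
  · intro v hv
    simpa [hv] using hmap v hv
  · intro v hv
    obtain ⟨k, hk⟩ := hp.reach v ((hA v).mp hv).1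
    refine ⟨k, ?_⟩
    rw [(iterate_eq_of_eqOn hmap (fun v hv => by simp [hv]) k v hv).1, hk]
  · intro v hv
    simp [hv]
  -- If an iterate of `p M` returned to `M`, then `M` would be the root.
  · exact (hA _).mpr ⟨hp.map_mem M hM, fun k e => hr (hp.eq_root_of_iterate_eq hM e).symm⟩
  · exact Finset.mem_sdiff.mpr ⟨hM, hMA⟩
  · simp
  · intro v hv
    split_ifs with h
    · refine Finset.mem_sdiff.mpr ⟨hp.map_mem v (Finset.mem_sdiff.mp hv).1, fun h1 => ?_⟩
      refine (Finset.mem_sdiff.mp hv).2 ((hA v).mpr ⟨(Finset.mem_sdiff.mp hv).1, fun k => ?_⟩)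
      cases k with
      | zero => exact h.2
      | succ k => exact ((hA _).mp h1).2 k
    · exact hv
  · intro v hv
    obtain ⟨hvS, hvA⟩ := Finset.mem_sdiff.mp hv
    have : ∃ k, p^[k] v = M := by
      by_contra! h
      exact hvA ((hA v).mpr ⟨hvS, h⟩)
    obtain ⟨k, hk⟩ := this
    clear hv hvA
    induction k generalizing v with
    | zero => exact ⟨0, hk⟩
    | succ k ih =>
      by_cases hvM : v = M
      · exact ⟨0, hvM⟩
      · obtain ⟨l, hl⟩ := ih (p v) (hp.map_mem v hvS) hk
        refine ⟨l + 1, ?_⟩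
        have hvA : v ∉ A := fun h => ((hA v).mp h).2 _ hk
        rw [Function.iterate_succ_apply, if_pos ⟨Finset.mem_sdiff.mpr ⟨hvS, hvA⟩, hvM⟩, hl]
  · intro v hv
    exact if_neg fun h => hv h.1
  · funext v
    unfold graft
    dsimp only
    split_ifs with h1 h2 h3
    · rfl
    · rw [h2]
    · rfl
    · have : v ∉ S := fun h => h3 ⟨Finset.mem_sdiff.mpr ⟨h, h1⟩, h2⟩
      exact (hp.map_of_notMem v this).symm

theorem card_recordMaps_add_two [Fintype V] {M : V} (hM : M ∈ S) (hmax : ∀ v ∈ S, v ≤ M) (k : ℕ) :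
    (recordMaps S (k + 2)).card = ∑ A ∈ (S.erase M).powerset,
      (recordMaps A (k + 1)).card * (A.card * (parentMaps (S \ A) M).card) := by
  simp_rw [← Finset.card_product]
  rw [← Finset.card_sigma]
  symm
  refine Finset.card_bij (fun x _ => graft M x.1 x.2.1 x.2.2.1 x.2.2.2) ?_ ?_ ?_
  · rintro ⟨A, p, u, q⟩ h
    simp only [Finset.mem_sigma, Finset.mem_powerset, Finset.mem_product, mem_recordMaps,
      mem_parentMaps] at h
    obtain ⟨hA, ⟨⟨r, hp⟩, hk⟩, hu, hq⟩ := h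
    have hA' := hA.trans (Finset.erase_subset _ _)
    exact mem_recordMaps.mpr ⟨⟨r, graft_isParentMap hA' hp hu hq⟩,
      by rw [card_recordSet_graft hA' hmax hp hu hq, hk]⟩
  · rintro ⟨A, p, u, q⟩ h ⟨A', p', u', q'⟩ h' heq
    simp only [Finset.mem_sigma, Finset.mem_powerset, Finset.mem_product, mem_recordMaps,
      mem_parentMaps] at h h'
    obtain ⟨hA, ⟨⟨r, hp⟩, hk⟩, hu, hq⟩ := h
    obtain ⟨hA', ⟨⟨r', hp'⟩, hk'⟩, hu', hq'⟩ := h'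
    dsimp only at heq
    have hAA : A = A' := by
      ext v
      by_cases hv : v ∈ S
      · rw [mem_iff_graft_iterate_ne (u := u) hp hq hv,
          mem_iff_graft_iterate_ne (u := u') hp' hq' hv, heq]
      · exact iff_of_false (fun h => hv (Finset.mem_of_mem_erase (hA h)))
          (fun h => hv (Finset.mem_of_mem_erase (hA' h)))
    subst hAA
    have hMA := (Finset.mem_sdiff.mp hq.root_mem).2
    have hpp : p = p' := by
      funext v
      by_cases hv : v ∈ A
      · simpa [graft, hv] using congrFun heq v
      · rw [hp.map_of_notMem v hv, hp'.map_of_notMem v hv]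
    have huu : u = u' := by simpa [graft, hMA] using congrFun heq M
    have hqq : q = q' := by
      funext v
      by_cases hv : v ∈ A
      · rw [hq.map_of_notMem v (by simp [hv]), hq'.map_of_notMem v (by simp [hv])]
      · by_cases hvM : v = M
        · rw [hvM, hq.map_root, hq'.map_root]
        · simpa [graft, hv, hvM] using congrFun heq v
    rw [hpp, huu, hqq]
  · intro p hp
    obtain ⟨⟨r, hp⟩, hk⟩ := mem_recordMaps.mp hp
    have hr : r ≠ M := by
      rintro rfl
      have := (mem_recordMaps.mp ((recordMaps_one hM hmax).symm ▸ mem_parentMaps.mpr hp)).2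
      omega
    obtain ⟨A, hA, p', q, hp', hu, hq, heq⟩ := exists_eq_graft hp hM hr
    have hc := card_recordSet_graft (hA.trans (Finset.erase_subset _ _)) hmax hp' hu hq
    rw [heq, hk] at hc
    refine ⟨⟨A, p', p M, q⟩, ?_, heq⟩
    simp only [Finset.mem_sigma, Finset.mem_powerset, Finset.mem_product, mem_recordMaps,
      mem_parentMaps]
    exact ⟨hA, ⟨⟨r, hp'⟩, by omega⟩, hu, hq⟩

theorem card_maps_eq [Fintype V] (n : ℕ) : ∀ S : Finset V, S.card = n → S.Nonempty →
    (∀ k, ((recordMaps S k).card : ℚ) = recordFormula n k) ∧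
    ∀ r ∈ S, ((parentMaps S r).card : ℚ) = (n : ℚ) ^ ((n : ℤ) - 2) := by
  induction n using Nat.strong_induction_on with
  | _ n ih =>
  intro S hS hne
  have hn : 1 ≤ n := hS ▸ hne.card_pos
  set M := S.max' hne
  have hM : M ∈ S := S.max'_mem hne
  have hmax : ∀ v ∈ S, v ≤ M := fun v hv => S.le_max' v hv
  have h0 : ((recordMaps S 0).card : ℚ) = recordFormula n 0 := by
    simp [recordMaps_zero, recordFormula]
  have h2 (k : ℕ) : ((recordMaps S (k + 2)).card : ℚ) = recordFormula n (k + 2) := by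
    rw [card_recordMaps_add_two hM hmax, ← sum_choose_mul_recordFormula hn]
    push_cast
    have hc : (S.erase M).card = n - 1 := by rw [Finset.card_erase_of_mem hM, hS]
    have key : ∀ A ∈ (S.erase M).powerset,
        ((recordMaps A (k + 1)).card : ℚ) * ((A.card : ℚ) * ((parentMaps (S \ A) M).card : ℚ)) =
        (fun s : ℕ => recordFormula s (k + 1) * s *
          ((n - s : ℕ) : ℚ) ^ (((n - s : ℕ) : ℤ) - 2)) A.card := by
      intro A hA
      rw [Finset.mem_powerset] at hA
      -- The induction hypothesis excludes the empty set, but there the factor `A.card` is zero.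
      rcases A.eq_empty_or_nonempty with rfl | hA0
      · simp
      · have hAc : A.card ≤ n - 1 := hc ▸ Finset.card_le_card hA
        have hsd : (S \ A).card = n - A.card := by
          rw [Finset.card_sdiff_of_subset (hA.trans (Finset.erase_subset _ _)), hS]
        have hMA : M ∈ S \ A := Finset.mem_sdiff.mpr ⟨hM, fun h => by simpa using hA h⟩
        have hpos := hA0.card_pos
        rw [(ih A.card (by omega) A rfl hA0).1 (k + 1),
          (ih (n - A.card) (by omega) (S \ A) hsd ⟨M, hMA⟩).2 M hMA, ← mul_assoc]
    rw [Finset.sum_congr rfl key, Finset.sum_powerset_apply_card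
      (fun s : ℕ => recordFormula s (k + 1) * s * ((n - s : ℕ) : ℚ) ^ (((n - s : ℕ) : ℤ) - 2)), hc,
      Nat.sub_add_cancel hn]
    exact Finset.sum_congr rfl fun s _ => nsmul_eq_mul _ _
  have ht : ((parentMaps S M).card : ℚ) = (n : ℚ) ^ ((n : ℤ) - 2) := by
    rcases hn.eq_or_lt with rfl | hn1
    · obtain ⟨r, hr⟩ := Finset.card_eq_one.mp hS
      have : M = r := by simpa [hr] using hM
      rw [hr, this, card_parentMaps_singleton]
      simp
    · have e1 := sum_recordFormula hn
      have e2 := congrArg (Nat.cast : ℕ → ℚ) (sum_card_recordMaps hM)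
      push_cast [hS] at e2
      -- Only the term `k = 1` is still unknown. The comparison becomes `(n - 1) t = (n - 1)
      -- n^(n-2)`, which determines `t` only for `n > 1`; hence the separate case `n = 1`.
      have e3 : ∑ k ∈ Finset.range (n + 1),
          (((recordMaps S k).card : ℚ) - recordFormula n k) =
          ((recordMaps S 1).card : ℚ) - recordFormula n 1 := by
        refine Finset.sum_eq_single 1 (fun k _ hk => ?_) (by simp; omega)
        match k, hk with
        | 0, _ => rw [h0, sub_self]
        | k + 2, _ => rw [h2, sub_self]
      have e4 : recordFormula n 1 = (n : ℚ) ^ ((n : ℤ) - 2) := by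
        simp only [recordFormula, Finset.Ico_self, Finset.prod_empty]
        rw [show (n : ℤ) - (1 : ℕ) - 1 = n - 2 by push_cast; ring]
        simp
      have hn0 : (n : ℚ) ≠ 0 := by positivity
      rw [Finset.sum_sub_distrib, e1, e2, recordMaps_one hM hmax, e4,
        show (n : ℤ) - 1 = n - 2 + 1 by ring, zpow_add_one₀ hn0] at e3
      have hn1' : ((n : ℚ) - 1) ≠ 0 := by
        have : (1 : ℚ) < n := by exact_mod_cast hn1
        linarith
      exact mul_left_cancel₀ hn1' (by linear_combination e3)
  refine ⟨fun k => ?_, fun r hr => by rw [card_parentMaps_eq hr hM, ht]⟩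
  match k with
  | 0 => exact h0
  | 1 =>
    rw [recordMaps_one hM hmax, ht, recordFormula,
      show (n : ℤ) - (1 : ℕ) - 1 = n - 2 by push_cast; ring]
    simp
  | k + 2 => exact h2 k

end Counting

/-! ### Parent maps and graph-theoretic trees -/

/-- The graph joining every vertex to its parent. -/
def parentGraph {V : Type*} (p : V → V) : SimpleGraph V :=
  SimpleGraph.fromRel fun v w => p v = w

section Bridge

variable {V : Type*} [Fintype V] {p : V → V} {r : V}

/-- The path to the root follows the iterates of `p`. Taking `G` up to equality allows paths from
two parent maps to be compared in one graph. -/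
theorem IsParentMap.exists_isPath (h : IsParentMap p Finset.univ r) {G : SimpleGraph V}
    (hG : parentGraph p = G) (v : V) :
    ∃ w : G.Walk v r, w.IsPath ∧ (∀ x, x ∈ w.support ↔ ∃ j, p^[j] v = x) ∧
      (v ≠ r → w.snd = p v) := by
  subst hG
  have hroot : ∃ w : (parentGraph p).Walk r r, w.IsPath ∧
      (∀ x, x ∈ w.support ↔ ∃ j, p^[j] r = x) ∧ (r ≠ r → w.snd = p r) :=
    ⟨.nil, .nil, fun x => by simp [Function.iterate_fixed h.map_root, eq_comm],
      fun h => absurd rfl h⟩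
  obtain ⟨k, hk⟩ := h.reach v (Finset.mem_univ v)
  induction k generalizing v with
  | zero => exact (show v = r from hk) ▸ hroot
  | succ k ih =>
    by_cases hv : v = r
    · exact hv ▸ hroot
    · obtain ⟨w, hw, hsupp, -⟩ := ih (p v) hk
      have hnp : ∀ j, p^[j + 1] v ≠ v := fun j e =>
        hv (h.eq_root_of_iterate_eq (Finset.mem_univ v) e)
      have hadj : (parentGraph p).Adj v (p v) := by
        rw [parentGraph, SimpleGraph.fromRel_adj]
        exact ⟨(hnp 0).symm, Or.inl rfl⟩
      refine ⟨.cons hadj w, ?_, fun x => ?_, fun _ => by simp⟩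
      · rw [SimpleGraph.Walk.cons_isPath_iff]
        refine ⟨hw, fun hm => ?_⟩
        obtain ⟨j, hj⟩ := (hsupp v).mp hm
        exact hnp j hj
      · rw [SimpleGraph.Walk.support_cons, List.mem_cons, hsupp]
        constructor
        · rintro (rfl | ⟨j, hj⟩)
          exacts [⟨0, rfl⟩, ⟨j + 1, hj⟩]
        · rintro ⟨_ | j, hj⟩
          exacts [Or.inl hj.symm, Or.inr ⟨j, hj⟩]

/-- The graph is connected through the root, and each edge is `s(v, p v)` for some `v ≠ r`, so there
are at most `|V| - 1` edges. -/
theorem IsParentMap.isTree_parentGraph (h : IsParentMap p Finset.univ r) :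
    (parentGraph p).IsTree := by
  classical
  have hc : (parentGraph p).Connected := by
    have : Nonempty V := ⟨r⟩
    refine ⟨fun v w => ?_⟩
    obtain ⟨a, -⟩ := h.exists_isPath rfl v
    obtain ⟨b, -⟩ := h.exists_isPath rfl w
    exact ⟨a.append b.reverse⟩
  refine SimpleGraph.isTree_iff_connected_and_card.mpr
    ⟨hc, le_antisymm ?_ hc.card_vert_le_card_edgeSet_add_one⟩
  have hsub : (parentGraph p).edgeSet ⊆
      ((Finset.univ.erase r).image fun v => s(v, p v) : Finset (Sym2 V)) := by
    intro e he
    induction e with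
    | _ a b =>
      rw [SimpleGraph.mem_edgeSet, parentGraph, SimpleGraph.fromRel_adj] at he
      rw [Finset.mem_coe, Finset.mem_image]
      rcases he with ⟨hab, rfl | rfl⟩
      · refine ⟨a, Finset.mem_erase.mpr ⟨?_, Finset.mem_univ a⟩, rfl⟩
        rintro rfl
        exact hab h.map_root.symm
      · refine ⟨b, Finset.mem_erase.mpr ⟨?_, Finset.mem_univ b⟩, Sym2.eq_swap⟩
        rintro rfl
        exact hab h.map_root
  have h1 := Set.ncard_le_ncard hsub (Finset.finite_toSet _)
  rw [Set.ncard_coe_finset] at h1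
  have h2 := h1.trans Finset.card_image_le
  rw [Finset.card_erase_of_mem (Finset.mem_univ r), Finset.card_univ] at h2
  have h3 : 0 < Fintype.card V := Fintype.card_pos_iff.mpr ⟨r⟩
  rw [Nat.card_coe_set_eq, Nat.card_eq_fintype_card]
  omega

/-- The rooted labelled tree with a given parent map. -/
def IsParentMap.tree (h : IsParentMap p Finset.univ r) : RootedLabelledTree V :=
  ⟨parentGraph p, h.isTree_parentGraph, r⟩

theorem IsParentMap.tree_injective {p' : V → V} {r' : V} (h : IsParentMap p Finset.univ r)
    (h' : IsParentMap p' Finset.univ r') (e : h.tree = h'.tree) : p = p' := by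
  have hG : parentGraph p' = parentGraph p := (congrArg RootedLabelledTree.graph e).symm
  have hr : r' = r := (congrArg RootedLabelledTree.root e).symm
  subst hr
  funext v
  by_cases hv : v = r'
  · rw [hv, h.map_root, h'.map_root]
  · obtain ⟨w, hw, -, hs⟩ := h.exists_isPath rfl v
    obtain ⟨w', hw', -, hs'⟩ := h'.exists_isPath hG v
    rw [← hs hv, ← hs' hv, (h.isTree_parentGraph.existsUnique_path v r').unique hw hw']

/-- The parent of `v ≠ r` is the second vertex on its path to `r`. The parent graph is then a
connected subgraph of `G`, and a tree is minimal among connected graphs. -/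
theorem RootedLabelledTree.exists_eq_tree (T : RootedLabelledTree V) :
    ∃ (p : V → V) (r : V) (h : IsParentMap p Finset.univ r), h.tree = T := by
  classical
  obtain ⟨G, hG, r⟩ := T
  choose w hw huniq using fun v => hG.existsUnique_path v r
  set p : V → V := fun v => if v = r then r else (w v).snd with hp
  have hstep (k : ℕ) : ∀ v (a : G.Walk v r), a.IsPath → a.length = k → p^[k] v = r := by
    induction k with
    | zero => exact fun v a _ h0 => SimpleGraph.Walk.eq_of_length_eq_zero h0
    | succ k ih =>
      intro v a ha hlen
      cases a with
      | nil => simp at hlen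
      | cons hadj b =>
        have hb := (SimpleGraph.Walk.cons_isPath_iff hadj b).mp ha
        have hv : v ≠ r := by
          rintro rfl
          exact hb.2 b.end_mem_support
        have : p v = (w v).snd := if_neg hv
        rw [Function.iterate_succ_apply, this, ← huniq v _ ha, SimpleGraph.Walk.snd_cons]
        exact ih _ b hb.1 (by simpa using hlen)
  have h : IsParentMap p Finset.univ r :=
    ⟨Finset.mem_univ r, if_pos rfl, fun v _ => Finset.mem_univ _,
      fun v _ => ⟨_, hstep _ v (w v) (hw v) rfl⟩, fun v hv => absurd (Finset.mem_univ v) hv⟩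
  have hadj (v : V) (hv : v ≠ r) : G.Adj v (p v) := by
    have : p v = (w v).snd := if_neg hv
    rw [this]
    exact SimpleGraph.Walk.adj_snd (SimpleGraph.Walk.not_nil_of_ne hv)
  have hle : parentGraph p ≤ G := by
    intro a b hab
    rw [parentGraph, SimpleGraph.fromRel_adj] at hab
    rcases hab with ⟨hab, rfl | rfl⟩
    · refine hadj a ?_
      rintro rfl
      exact hab h.map_root.symm
    · refine (hadj b ?_).symm
      rintro rfl
      exact hab h.map_root
  refine ⟨p, r, h, ?_⟩
  have hGp : parentGraph p = G := le_antisymm hle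
    ((SimpleGraph.isTree_iff_minimal_connected.mp hG).2 h.isTree_parentGraph.connected hle)
  simp only [IsParentMap.tree, hGp]

theorem IsParentMap.numRecords_tree [LinearOrder V] (h : IsParentMap p Finset.univ r) :
    h.tree.numRecords = (recordSet p Finset.univ).card := by
  rw [RootedLabelledTree.numRecords, ← Set.ncard_coe_finset]
  congr 1
  ext v
  rw [Set.mem_ofPred_eq, Finset.mem_coe, mem_recordSet]
  obtain ⟨w, hw, hsupp, -⟩ := h.exists_isPath rfl v
  have hsupp' (x : V) : x ∈ w.reverse.support ↔ ∃ j, p^[j] v = x := by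
    rw [SimpleGraph.Walk.support_reverse, List.mem_reverse, hsupp]
  constructor
  · intro hrec
    exact ⟨Finset.mem_univ v, fun k => hrec w.reverse hw.reverse _ ((hsupp' _).mpr ⟨k, rfl⟩)⟩
  · rintro ⟨-, hrec⟩ (a : (parentGraph p).Walk r v) ha x hx
    have haw : a = w.reverse :=
      (h.isTree_parentGraph.existsUnique_path r v).unique ha hw.reverse
    subst haw
    obtain ⟨j, rfl⟩ := (hsupp' x).mp hx
    exact hrec j

end Bridge

theorem treeRecordNumber_eq_card (n k : ℕ) :
    treeRecordNumber n k = (recordMaps (Finset.univ : Finset (Fin n)) k).card := by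
  rw [treeRecordNumber, ← Set.ncard_coe_finset]
  symm
  refine Set.ncard_congr (fun p hp => (mem_recordMaps.mp hp).1.choose_spec.tree) ?_ ?_ ?_
  · intro p hp
    exact (IsParentMap.numRecords_tree _).trans (mem_recordMaps.mp hp).2
  · intro p q hp hq e
    exact IsParentMap.tree_injective _ _ e
  · intro T hT
    obtain ⟨p, r, h, rfl⟩ := T.exists_eq_tree
    refine ⟨p, mem_recordMaps.mpr ⟨⟨r, h⟩, h.numRecords_tree.symm.trans hT⟩, ?_⟩
    -- The root picked by choice agrees with `r` because a parent map determines its root.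
    have hr (h' : ∃ r, IsParentMap p Finset.univ r) : h'.choose_spec.tree = h.tree := by
      have e := h'.choose_spec.root_unique h
      simp only [IsParentMap.tree, e]
    exact hr _

theorem mainTheorem1 (n k : ℕ) (hn : 1 ≤ n) :
    (treeRecordNumber n k : ℚ) =
      (k : ℚ) * (∏ i ∈ Finset.Ico 1 k, ((n : ℚ) - (i : ℚ))) * (n : ℚ) ^ ((n : ℤ) - (k : ℤ) - 1) := by
  rw [treeRecordNumber_eq_card]
  have : Nonempty (Fin n) := ⟨⟨0, hn⟩⟩
  exact (card_maps_eq n Finset.univ (by simp) Finset.univ_nonempty).1 k
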